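/- Let $n\in\mathbb{N}$ and let $A,B$ be positive semidefinite complex $n\times n$ matrices with $B$ positive definite. For $\alpha,z>0$ with $\alpha\neq1$ put $$P_\alpha(A,B):=B^{1/2}\bigl(B^{-1/2}AB^{-1/2}\bigr)^{\alpha}B^{1/2},\qquad Q_{\alpha,z}(A,B):=\Bigl(B^{\frac{1-\alpha}{2z}}A^{\frac{\alpha}{z}}B^{\frac{1-\alpha}{2z}}\Bigr)^{z},$$ $$Q_\alpha(A,B):=Q_{\alpha,1}(A,B)=B^{\frac{1-\alpha}{2}}A^{\alpha}B^{\frac{1-\alpha}{2}}.$$ For positive semidefinite $n\times n$ matrices $X,Y$, the log-majorization $X\prec_{\log}Y$ means that $\prod_{i=1}^k\lambda_i(X)\le\prod_{i=1}^k\lambda_i(Y)$ for $k=1,\dots,n$, with equality for $k=n$, where $\lambda_1(\cdot)\ge\dots\ge\lambda_n(\cdot)$ are the eigenvalues in decreasing order counted with multiplicity. Then: (1) if $0<\alpha<1$ and $z>0$, then $P_\alpha(A,B)\prec_{\log}Q_{\alpha,z}(A,B)$; (2) if $\alpha>1$ and $0<z\le\min\{\alpha/2,\alpha-1\}$, then $P_\alpha(A,B)\prec_{\log}Q_{\alpha,z}(A,B)$;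 (3) if $\alpha>1$ and $z\ge\max\{\alpha/2,\alpha-1\}$, then $Q_{\alpha,z}(A,B)\prec_{\log}P_\alpha(A,B)$. In particular, $P_\alpha(A,B)\prec_{\log}Q_\alpha(A,B)$ if $0<\alpha<1$ or $\alpha\ge2$, and $Q_\alpha(A,B)\prec_{\log}P_\alpha(A,B)$ if $1<\alpha\le2$. -/

import Mathlib

namespace Renyi

open scoped ComplexOrder MatrixOrder

variable {ι : Type*} [Fintype ι] [DecidableEq ι]

/-- `P_α(A,B) = B^{1/2} (B^{-1/2} A B^{-1/2})^α B^{1/2}`. Real powers of matrices are those of the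
continuous functional calculus (so `0 ^ r = 0` on a kernel for `r > 0`). -/
noncomputable def P (α : ℝ) (A B : Matrix ι ι ℂ) : Matrix ι ι ℂ :=
  B ^ (1 / 2 : ℝ) * (B ^ (-(1 / 2) : ℝ) * A * B ^ (-(1 / 2) : ℝ)) ^ α * B ^ (1 / 2 : ℝ)

/-- `Q_{α,z}(A,B) = (B^{(1-α)/(2z)} A^{α/z} B^{(1-α)/(2z)})^z`. -/
noncomputable def Q (α z : ℝ) (A B : Matrix ι ι ℂ) : Matrix ι ι ℂ :=
  (B ^ ((1 - α) / (2 * z)) * A ^ (α / z) * B ^ ((1 - α) / (2 * z))) ^ z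

/-- `Q_α(A,B) = Q_{α,1}(A,B)`. -/
noncomputable def Q₁ (α : ℝ) (A B : Matrix ι ι ℂ) : Matrix ι ι ℂ :=
  Q α 1 A B

/-- `Q_α(A,B) = B^{(1-α)/2} A^α B^{(1-α)/2}`. -/
theorem Q₁_eq (α : ℝ) (A B : Matrix ι ι ℂ) :
    Q₁ α A B = B ^ ((1 - α) / 2) * A ^ α * B ^ ((1 - α) / 2) := by
  have hB : IsSelfAdjoint (B ^ ((1 - α) / 2)) :=
    IsSelfAdjoint.of_nonneg CFC.rpow_nonneg
  have h : 0 ≤ B ^ ((1 - α) / 2) * A ^ α * B ^ ((1 - α) / 2) :=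
    hB.conjugate_nonneg CFC.rpow_nonneg
  simp only [Q₁, Q, mul_one, div_one]
  exact CFC.rpow_one _ h

/-- Log-majorization `X ≺_log Y` of positive semidefinite matrices. `eigenvalues₀` lists the
eigenvalues in decreasing order, with multiplicity, indexed from `0`. -/
def LogMajorizedBy (X Y : Matrix ι ι ℂ) : Prop :=
  ∃ (hX : X.PosSemidef) (hY : Y.PosSemidef),
    (∀ k : ℕ, 1 ≤ k → k ≤ Fintype.card ι →
      ∏ i : Fin (Fintype.card ι) with i.val < k, hX.isHermitian.eigenvalues₀ i ≤
        ∏ i : Fin (Fintype.card ι) with i.val < k, hY.isHermitian.eigenvalues₀ i) ∧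
    ∏ i, hX.isHermitian.eigenvalues₀ i = ∏ i, hY.isHermitian.eigenvalues₀ i

end Renyi

open scoped ComplexOrder

/-!
The `k`-th compound of a matrix (its `k`-th exterior power) is multiplicative, commutes with real
powers, and has as norm the product of the `k` largest eigenvalues. So the compounds of `P_α(A, B)`
and `Q_{α,z}(A, B)` are `P_α` and `Q_{α,z}` of the compounds, and log-majorization follows from
inequalities between `‖P_α‖` and `‖Q_{α,z}‖`, the determinants being equal. Both sides scale in the
same way with `A`, so it is enough to compare `P_α ≤ 1` with `Q_{α,z} ≤ 1`, which holds iff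
`A ^ (α / z) ≤ B ^ ((α - 1) / z)`. Furuta's inequality settles `α < 1` and the Löwner–Heinz
inequality settles `1 < α ≤ 2` and the reverse direction. For `α ≥ 2` put
`K = B ^ (-1/2) A B ^ (-1/2)` and `G = B ^ (-1/α)`: here `K G ^ (-α) K ≤ G ^ (2 - α)` is also
`K G ^ (α - 2) K ≤ G ^ α`, since `‖X‖ = ‖X⋆‖`. Hansen's inequality interpolates the two to
`K G ^ u K ≤ G ^ (2 + u)` for `0 ≤ u ≤ α - 2`, and these build up `K ^ α ≤ G ^ α = B⁻¹` two
exponents at a time.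
-/

namespace Renyi

open scoped MatrixOrder

section CStarAlgebra

variable {𝒜 : Type*} [CStarAlgebra 𝒜] [PartialOrder 𝒜] [StarOrderedRing 𝒜]

section RealPowers

variable {a b c : 𝒜}

theorem star_rpow (a : 𝒜) (r : ℝ) : star (a ^ r) = a ^ r :=
  (IsSelfAdjoint.of_nonneg CFC.rpow_nonneg).star_eq

theorem rpow_rpow (ha : IsStrictlyPositive a) (x y : ℝ) : (a ^ x) ^ y = a ^ (x * y) := by
  rcases eq_or_ne x 0 with rfl | hx
  · simp [CFC.rpow_zero a ha.nonneg]
  · exact CFC.rpow_rpow a x y hx ha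

theorem rpow_mul_rpow (ha : IsStrictlyPositive a) (x y : ℝ) : a ^ x * a ^ y = a ^ (x + y) :=
  (CFC.rpow_add ha.isUnit).symm

theorem rpow_mul_rpow_mul_rpow (ha : IsStrictlyPositive a) (x y z : ℝ) :
    a ^ x * a ^ y * a ^ z = a ^ (x + y + z) := by
  rw [rpow_mul_rpow ha, rpow_mul_rpow ha]

theorem isUnit_rpow (ha : IsStrictlyPositive a) (r : ℝ) : IsUnit (a ^ r) :=
  ha.isUnit.cfcRpow r ha.nonneg

theorem smul_rpow (ha : IsStrictlyPositive a) {t : ℝ} (ht : 0 < t) (r : ℝ) :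
    (t • a) ^ r = t ^ r • a ^ r := by
  have h0 : ∀ x ∈ spectrum ℝ a, 0 < x :=
    (StarOrderedRing.isStrictlyPositive_iff_spectrum_pos a).1 ha
  have hta : 0 ≤ t • a := smul_nonneg ht.le ha.nonneg
  have hcont : ContinuousOn (fun x : ℝ => x ^ r) (spectrum ℝ a) := fun x hx =>
    (Real.continuousAt_rpow_const _ _ (.inl (h0 x hx).ne')).continuousWithinAt
  have hcont' : ContinuousOn (fun x : ℝ => x ^ r) ((t • ·) '' spectrum ℝ a) := by
    rintro _ ⟨x, hx, rfl⟩
    exact (Real.continuousAt_rpow_const _ _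
      (.inl (mul_pos ht (h0 x hx)).ne')).continuousWithinAt
  rw [CFC.rpow_eq_cfc_real hta, CFC.rpow_eq_cfc_real ha.nonneg, ← cfc_smul _ _ a hcont,
    ← cfc_comp_smul t _ a hcont']
  exact cfc_congr fun x hx => Real.mul_rpow ht.le (h0 x hx).le

theorem isStrictlyPositive_smul (ha : IsStrictlyPositive a) {t : ℝ} (ht : 0 < t) :
    IsStrictlyPositive (t • a) :=
  ⟨smul_nonneg ht.le ha.nonneg, ha.isUnit.smul (Units.mk0 t ht.ne')⟩

theorem continuousOn_rpow {r : ℝ} (hr : 0 < r) :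
    ContinuousOn (fun a : 𝒜 => a ^ r) {a | 0 ≤ a} := by
  lift r to NNReal using hr.le
  have hr' : 0 < r := by exact_mod_cast hr
  simp_rw [← CFC.nnrpow_eq_rpow hr']
  exact CFC.continuousOn_nnrpow r

theorem rpow_le_one_iff (ha : 0 ≤ a) {r : ℝ} (hr : 0 < r) : a ^ r ≤ 1 ↔ a ≤ 1 := by
  rw [← CStarAlgebra.norm_le_one_iff_of_nonneg _ CFC.rpow_nonneg,
    ← CStarAlgebra.norm_le_one_iff_of_nonneg _ ha, CFC.norm_rpow a hr ha,
    ← Real.rpow_le_rpow_iff (norm_nonneg a) zero_le_one hr, Real.one_rpow]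

theorem rpow_le_rpow_of_nonpos (ha : IsStrictlyPositive a) (hab : a ≤ b) {r : ℝ}
    (hr : r ∈ Set.Icc (-1 : ℝ) 0) : b ^ r ≤ a ^ r := by
  have h := CFC.rpow_le_rpow (p := -r) ⟨by linarith [hr.2], by linarith [hr.1]⟩
    (CStarAlgebra.rpow_neg_one_le_rpow_neg_one hab ha)
  rwa [rpow_rpow ha, rpow_rpow (ha.of_le hab), neg_one_mul, neg_neg] at h

theorem rpow_mul_mul_rpow_nonneg (ha : 0 ≤ a) (b : 𝒜) (r : ℝ) : 0 ≤ b ^ r * a * b ^ r :=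
  conjugate_nonneg_of_nonneg ha CFC.rpow_nonneg

theorem isStrictlyPositive_rpow_mul_mul_rpow (ha : IsStrictlyPositive a)
    (hb : IsStrictlyPositive b) (r : ℝ) : IsStrictlyPositive (b ^ r * a * b ^ r) :=
  ⟨rpow_mul_mul_rpow_nonneg ha.nonneg b r,
    ((isUnit_rpow hb r).mul ha.isUnit).mul (isUnit_rpow hb r)⟩

theorem rpow_mul_mul_rpow_le (hab : a ≤ b) (c : 𝒜) (r : ℝ) :
    c ^ r * a * c ^ r ≤ c ^ r * b * c ^ r :=
  conjugate_le_conjugate_of_nonneg hab CFC.rpow_nonneg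

theorem rpow_mul_rpow_neg_mul_mul (hc : IsStrictlyPositive c) (a : 𝒜) (r : ℝ) :
    c ^ r * (c ^ (-r) * a * c ^ (-r)) * c ^ r = a := by
  calc c ^ r * (c ^ (-r) * a * c ^ (-r)) * c ^ r
      = c ^ r * c ^ (-r) * a * (c ^ (-r) * c ^ r) := by simp only [mul_assoc]
    _ = a := by rw [CFC.rpow_mul_rpow_neg r hc, CFC.rpow_neg_mul_rpow r hc, one_mul, mul_one]

theorem rpow_neg_mul_mul_rpow_neg_le_iff (hc : IsStrictlyPositive c) (r : ℝ) :
    c ^ (-r) * a * c ^ (-r) ≤ b ↔ a ≤ c ^ r * b * c ^ r := by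
  constructor <;> intro h
  · simpa only [rpow_mul_rpow_neg_mul_mul hc] using rpow_mul_mul_rpow_le h c r
  · have hb := rpow_mul_rpow_neg_mul_mul hc b (-r)
    rw [neg_neg] at hb
    exact (rpow_mul_mul_rpow_le h c (-r)).trans_eq hb

theorem conjStarAlgAut_rpow (u : unitary 𝒜) (ha : IsStrictlyPositive a) (r : ℝ) :
    (Unitary.conjStarAlgAut ℂ 𝒜 u a) ^ r = Unitary.conjStarAlgAut ℂ 𝒜 u (a ^ r) := by
  have hs : (0 : NNReal) ∉ spectrum NNReal a := spectrum.zero_notMem _ ha.isUnit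
  exact (StarAlgHomClass.map_cfc (R := NNReal) (S := ℂ) (Unitary.conjStarAlgAut ℂ 𝒜 u)
    (fun x : NNReal => x ^ r) a (NNReal.continuousOn_rpow_const (.inl hs))
    (StarAlgEquiv.isometry _).continuous ha.nonneg
    (map_nonneg _ ha.nonneg)).symm

theorem isStrictlyPositive_mul_star {x : 𝒜} (hx : IsUnit x) : IsStrictlyPositive (x * star x) :=
  ⟨mul_star_self_nonneg x, hx.mul hx.star⟩

theorem mul_star_le_one {x : 𝒜} (hx : star x * x ≤ 1) : x * star x ≤ 1 := by
  rw [← CStarAlgebra.norm_le_one_iff_of_nonneg _ (mul_star_self_nonneg x),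
    CStarRing.norm_self_mul_star]
  rwa [← CStarAlgebra.norm_le_one_iff_of_nonneg _ (star_mul_self_nonneg x),
    CStarRing.norm_star_mul_self] at hx

theorem mul_rpow_neg_one_half_mem_unitary {x : 𝒜} (hx : IsUnit x) :
    x * (star x * x) ^ (-(1 / 2) : ℝ) ∈ unitary 𝒜 := by
  have ha : IsStrictlyPositive (star x * x) := by simpa using isStrictlyPositive_mul_star hx.star
  refine (hx.mul (isUnit_rpow ha _)).mem_unitary_of_star_mul_self ?_
  rw [← CFC.conjugate_rpow_neg_one_half (star x * x), star_mul, star_rpow]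
  simp only [mul_assoc]

theorem mul_star_rpow {x : 𝒜} (hx : IsUnit x) (r : ℝ) :
    (x * star x) ^ r = x * (star x * x) ^ (r - 1) * star x := by
  have ha : IsStrictlyPositive (star x * x) := by simpa using isStrictlyPositive_mul_star hx.star
  have hconj (s : ℝ) : Unitary.conjStarAlgAut ℂ 𝒜 ⟨_, mul_rpow_neg_one_half_mem_unitary hx⟩
      ((star x * x) ^ s) = x * (star x * x) ^ (s - 1) * star x := by
    calc _ = x * ((star x * x) ^ (-(1 / 2) : ℝ) * (star x * x) ^ s *
          (star x * x) ^ (-(1 / 2) : ℝ)) * star x := by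
          simp only [Unitary.conjStarAlgAut_apply, star_mul, star_rpow, mul_assoc]
      _ = _ := by rw [rpow_mul_rpow_mul_rpow ha]; ring_nf
  have hone := hconj 1
  rw [CFC.rpow_one _ ha.nonneg, sub_self, CFC.rpow_zero _ ha.nonneg, mul_one] at hone
  rw [← hone, conjStarAlgAut_rpow _ ha, hconj]

theorem rpow_mul_rpow_mul_rpow_rpow (ha : IsStrictlyPositive a) (hb : IsStrictlyPositive b)
    (s t r : ℝ) :
    (b ^ t * a ^ s * b ^ t) ^ r = b ^ t * (a ^ (s / 2) *
      (a ^ (s / 2) * b ^ (2 * t) * a ^ (s / 2)) ^ (r - 1) * a ^ (s / 2)) * b ^ t := by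
  have h := mul_star_rpow ((isUnit_rpow hb t).mul (isUnit_rpow ha (s / 2))) r
  have h₁ : b ^ t * a ^ (s / 2) * (a ^ (s / 2) * b ^ t) = b ^ t * a ^ s * b ^ t := by
    rw [← add_halves s, ← rpow_mul_rpow ha, add_halves]
    simp only [mul_assoc]
  have h₂ : a ^ (s / 2) * b ^ t * (b ^ t * a ^ (s / 2)) =
      a ^ (s / 2) * b ^ (2 * t) * a ^ (s / 2) := by
    rw [two_mul, ← rpow_mul_rpow hb]
    simp only [mul_assoc]
  rw [star_mul, star_rpow, star_rpow, h₁, h₂] at h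
  rw [h]
  simp only [mul_assoc]

theorem rpow_mul_rpow_mul_rpow_rpow_le_of_rpow_le (ha : IsStrictlyPositive a)
    (hb : IsStrictlyPositive b) {q r s t : ℝ} (h : a ^ q ≤ b ^ (2 * t))
    (hr : r ∈ Set.Icc (0 : ℝ) 1) :
    (b ^ t * a ^ s * b ^ t) ^ r ≤ b ^ t * a ^ (s * r + q * (r - 1)) * b ^ t := by
  have hconj : a ^ (s + q) ≤ a ^ (s / 2) * b ^ (2 * t) * a ^ (s / 2) := by
    have := rpow_mul_mul_rpow_le h a (s / 2)
    rwa [rpow_mul_rpow_mul_rpow ha, add_right_comm, add_halves] at this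
  have hpow := rpow_le_rpow_of_nonpos (r := r - 1) (ha.rpow _ _) hconj
    ⟨by linarith [hr.1], by linarith [hr.2]⟩
  rw [rpow_mul_rpow_mul_rpow_rpow ha hb]
  refine rpow_mul_mul_rpow_le ((rpow_mul_mul_rpow_le hpow a _).trans_eq ?_) b t
  rw [rpow_rpow ha, rpow_mul_rpow_mul_rpow ha]
  ring_nf

theorem rpow_mul_rpow_mul_rpow_rpow_le_of_le_rpow (ha : IsStrictlyPositive a)
    (hb : IsStrictlyPositive b) {q r s t : ℝ} (h : b ^ (2 * t) ≤ a ^ q)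
    (hr : r ∈ Set.Icc (1 : ℝ) 2) :
    (b ^ t * a ^ s * b ^ t) ^ r ≤ b ^ t * a ^ (s * r + q * (r - 1)) * b ^ t := by
  have hpow := CFC.rpow_le_rpow (p := r - 1) ⟨by linarith [hr.1], by linarith [hr.2]⟩
    (rpow_mul_mul_rpow_le h a (s / 2))
  rw [rpow_mul_rpow_mul_rpow_rpow ha hb]
  refine rpow_mul_mul_rpow_le ((rpow_mul_mul_rpow_le hpow a _).trans_eq ?_) b t
  rw [rpow_mul_rpow_mul_rpow ha, rpow_rpow ha, rpow_mul_rpow_mul_rpow ha]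
  ring_nf

end RealPowers

section Furuta

variable {a b : 𝒜} {r s : ℝ}

theorem furuta_of_le_one (ha : IsStrictlyPositive a) (hab : a ≤ b) (hr : 0 ≤ r) (hr1 : r ≤ 1)
    (hs : 1 ≤ s) : (b ^ (r / 2) * a ^ s * b ^ (r / 2)) ^ ((1 + r) / (s + r)) ≤ b ^ (1 + r) := by
  have hb : IsStrictlyPositive b := ha.of_le hab
  have hsr : 0 < s + r := by linarith
  have hpow : a ^ r ≤ b ^ (2 * (r / 2)) := by
    rw [mul_div_cancel₀ _ two_ne_zero]
    exact CFC.rpow_le_rpow ⟨hr, hr1⟩ hab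
  have h := rpow_mul_rpow_mul_rpow_rpow_le_of_rpow_le (s := s) (r := (1 + r) / (s + r)) ha hb hpow
    ⟨by positivity, by rw [div_le_one hsr]; linarith⟩
  rw [show s * ((1 + r) / (s + r)) + r * ((1 + r) / (s + r) - 1) = 1 by field_simp; ring,
    CFC.rpow_one a ha.nonneg] at h
  calc _ ≤ b ^ (r / 2) * b ^ (1 : ℝ) * b ^ (r / 2) := by
        rw [CFC.rpow_one b hb.nonneg]
        exact h.trans (rpow_mul_mul_rpow_le hab b _)
    _ = b ^ (1 + r) := by rw [rpow_mul_rpow_mul_rpow hb]; ring_nf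

theorem furuta_two_mul_add_one {q : ℝ} (ha : IsStrictlyPositive a) (hb : IsStrictlyPositive b)
    (hq : 0 ≤ q) (hs : 1 ≤ s)
    (h : (b ^ (q / 2) * a ^ s * b ^ (q / 2)) ^ ((1 + q) / (s + q)) ≤ b ^ (1 + q)) :
    (b ^ ((2 * q + 1) / 2) * a ^ s * b ^ ((2 * q + 1) / 2)) ^
      ((1 + (2 * q + 1)) / (s + (2 * q + 1))) ≤ b ^ (1 + (2 * q + 1)) := by
  have : 0 < s + q := by linarith
  have hc : IsStrictlyPositive (b ^ (q / 2) * a ^ s * b ^ (q / 2)) :=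
    isStrictlyPositive_rpow_mul_mul_rpow (ha.rpow a s) hb _
  have hstep := furuta_of_le_one (hc.rpow _ ((1 + q) / (s + q))) h zero_le_one le_rfl
    (s := (s + q) / (1 + q)) (by rw [le_div_iff₀ (by linarith)]; linarith)
  rw [rpow_rpow hc, rpow_rpow hb, rpow_rpow hb,
    show (1 + q) / (s + q) * ((s + q) / (1 + q)) = 1 by field_simp,
    CFC.rpow_one _ hc.nonneg] at hstep
  have hconj : b ^ ((1 + q) * (1 / 2)) * (b ^ (q / 2) * a ^ s * b ^ (q / 2)) *
      b ^ ((1 + q) * (1 / 2)) = b ^ ((2 * q + 1) / 2) * a ^ s * b ^ ((2 * q + 1) / 2) := by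
    calc _ = b ^ ((1 + q) * (1 / 2)) * b ^ (q / 2) * a ^ s *
          (b ^ (q / 2) * b ^ ((1 + q) * (1 / 2))) := by simp only [mul_assoc]
      _ = _ := by rw [rpow_mul_rpow hb, rpow_mul_rpow hb]; ring_nf
  rw [hconj] at hstep
  convert hstep using 2
  · have : s + q + (1 + q) ≠ 0 := by positivity
    have : s + (2 * q + 1) ≠ 0 := by positivity
    field_simp
    ring
  · ring

theorem furuta (ha : IsStrictlyPositive a) (hab : a ≤ b) (hr : 0 ≤ r) (hs : 1 ≤ s) :
    (b ^ (r / 2) * a ^ s * b ^ (r / 2)) ^ ((1 + r) / (s + r)) ≤ b ^ (1 + r) := by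
  obtain ⟨n, hn⟩ := pow_unbounded_of_one_lt (1 + r) (one_lt_two : (1 : ℝ) < 2)
  induction n generalizing r with
  | zero => exact furuta_of_le_one ha hab hr (by norm_num at hn; linarith) hs
  | succ n ih =>
    rcases le_total r 1 with hr1 | hr1
    · exact furuta_of_le_one ha hab hr hr1 hs
    obtain ⟨q, rfl⟩ : ∃ q, r = 2 * q + 1 := ⟨(r - 1) / 2, by ring⟩
    have hq : 0 ≤ q := by linarith
    exact furuta_two_mul_add_one ha (ha.of_le hab) hq hs (ih hq (by rw [pow_succ] at hn; linarith))

theorem rpow_mul_rpow_mul_rpow_rpow_le_rpow (ha : IsStrictlyPositive a) (hab : a ≤ b) (hr : 0 < r)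
    (hs : 0 < s) : (b ^ (r / 2) * a ^ s * b ^ (r / 2)) ^ (r / (s + r)) ≤ b ^ r := by
  have hb : IsStrictlyPositive b := ha.of_le hab
  rcases le_total 1 s with hs1 | hs1
  · have h := CFC.rpow_le_rpow (p := r / (1 + r))
      ⟨by positivity, by rw [div_le_one (by positivity)]; linarith⟩ (furuta ha hab hr.le hs1)
    rw [rpow_rpow (isStrictlyPositive_rpow_mul_mul_rpow (ha.rpow a s) hb _), rpow_rpow hb] at h
    convert h using 2 <;> field_simp
  · have h := CFC.rpow_le_rpow (p := r / (s + r))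
      ⟨by positivity, by rw [div_le_one (by positivity)]; linarith⟩
      (rpow_mul_mul_rpow_le (CFC.rpow_le_rpow ⟨hs.le, hs1⟩ hab) b (r / 2))
    rw [rpow_mul_rpow_mul_rpow hb, rpow_rpow hb] at h
    convert h using 2
    field_simp
    ring

end Furuta

section Interpolation

variable {a t k g h : 𝒜}

theorem hansen_rpow (ht : IsUnit t) (ht1 : t * star t ≤ 1) (hh : IsStrictlyPositive h)
    {p : ℝ} (hp : p ∈ Set.Icc (0 : ℝ) 1) : star t * h ^ p * t ≤ (star t * h * t) ^ p := by
  have hsqrt : h ^ (1 / 2 : ℝ) * h ^ (1 / 2 : ℝ) = h := by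
    rw [rpow_mul_rpow hh, add_halves, CFC.rpow_one h hh.nonneg]
  have hpolar := mul_star_rpow (ht.star.mul (isUnit_rpow hh (1 / 2))) p
  have h₁ : star t * h ^ (1 / 2 : ℝ) * (h ^ (1 / 2 : ℝ) * t) = star t * h * t := by
    rw [← mul_assoc, mul_assoc (star t), hsqrt]
  have h₂ : h ^ (1 / 2 : ℝ) * t * (star t * h ^ (1 / 2 : ℝ)) =
      h ^ (1 / 2 : ℝ) * (t * star t) * h ^ (1 / 2 : ℝ) := by simp only [mul_assoc]
  rw [star_mul, star_rpow, star_star, h₁, h₂] at hpolar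
  have hle : h ^ (1 / 2 : ℝ) * (t * star t) * h ^ (1 / 2 : ℝ) ≤ h := by
    simpa only [mul_one, hsqrt] using rpow_mul_mul_rpow_le ht1 h (1 / 2)
  have hpow := rpow_le_rpow_of_nonpos (r := p - 1)
    (isStrictlyPositive_rpow_mul_mul_rpow (isStrictlyPositive_mul_star ht) hh _) hle
    ⟨by linarith [hp.1], by linarith [hp.2]⟩
  calc star t * h ^ p * t
      = star t * (h ^ (1 / 2 : ℝ) * h ^ (p - 1) * h ^ (1 / 2 : ℝ)) * t := by
        rw [rpow_mul_rpow_mul_rpow hh]; ring_nf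
    _ ≤ star t * (h ^ (1 / 2 : ℝ) * (h ^ (1 / 2 : ℝ) * (t * star t) * h ^ (1 / 2 : ℝ)) ^ (p - 1) *
          h ^ (1 / 2 : ℝ)) * t :=
        star_left_conjugate_le_conjugate (rpow_mul_mul_rpow_le hpow h _) t
    _ = (star t * h * t) ^ p := by rw [hpolar]; simp only [mul_assoc]

theorem star_mul_rpow_mul_le_one_iff (hk : IsSelfAdjoint k) (hg : IsStrictlyPositive g) (x y : ℝ) :
    star (g ^ x * k * g ^ (-y)) * (g ^ x * k * g ^ (-y)) ≤ 1 ↔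
      k * g ^ (2 * x) * k ≤ g ^ (2 * y) := by
  have hgy : g ^ (2 * y) = g ^ y * 1 * g ^ y := by rw [mul_one, rpow_mul_rpow hg, two_mul]
  rw [hgy, ← rpow_neg_mul_mul_rpow_neg_le_iff hg, two_mul x, ← rpow_mul_rpow hg]
  simp only [star_mul, star_rpow, hk.star_eq, mul_assoc]

theorem mul_rpow_neg_mul_le_rpow_neg (hk : IsSelfAdjoint k) (hg : IsStrictlyPositive g) {x y : ℝ}
    (h : k * g ^ x * k ≤ g ^ y) : k * g ^ (-y) * k ≤ g ^ (-x) := by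
  have hcontr := (star_mul_rpow_mul_le_one_iff hk hg (x / 2) (y / 2)).2
    (by simpa only [mul_div_cancel₀ _ (two_ne_zero' ℝ)] using h)
  have hcontr' := (star_mul_rpow_mul_le_one_iff hk hg (-(y / 2)) (-(x / 2))).1 (by
    simpa only [star_mul, star_rpow, hk.star_eq, neg_neg, mul_assoc] using mul_star_le_one hcontr)
  simpa only [mul_neg, mul_div_cancel₀ _ (two_ne_zero' ℝ)] using hcontr'

theorem mul_rpow_mul_le_rpow_of_endpoints (hk : IsStrictlyPositive k) (hg : IsStrictlyPositive g)
    {x x' y y' θ : ℝ} (hx : k * g ^ x * k ≤ g ^ x') (hy : k * g ^ y * k ≤ g ^ y')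
    (hθ : θ ∈ Set.Icc (0 : ℝ) 1) :
    k * g ^ (x + (y - x) * θ) * k ≤ g ^ (x' + (y' - x') * θ) := by
  have hks : IsSelfAdjoint k := .of_nonneg hk.nonneg
  set t := g ^ (x / 2) * k * g ^ (-(x' / 2)) with ht
  have htu : IsUnit t := ((isUnit_rpow hg _).mul hk.isUnit).mul (isUnit_rpow hg _)
  have ht1 : star t * t ≤ 1 := (star_mul_rpow_mul_le_one_iff hks hg _ _).2
    (by simpa only [mul_div_cancel₀ _ (two_ne_zero' ℝ)] using hx)
  have hconj (c d : ℝ) :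
      star t * g ^ c * t ≤ g ^ d ↔ k * g ^ (x + c) * k ≤ g ^ (x' + d) := by
    have h₁ : g ^ (x' + d) = g ^ (x' / 2) * g ^ d * g ^ (x' / 2) := by
      rw [rpow_mul_rpow_mul_rpow hg]; ring_nf
    have h₂ : g ^ (x + c) = g ^ (x / 2) * g ^ c * g ^ (x / 2) := by
      rw [rpow_mul_rpow_mul_rpow hg]; ring_nf
    rw [h₁, h₂, ← rpow_neg_mul_mul_rpow_neg_le_iff hg, ht]
    simp only [star_mul, star_rpow, hks.star_eq, mul_assoc]
  rw [← hconj, ← rpow_rpow hg, ← rpow_rpow hg]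
  exact (hansen_rpow htu (mul_star_le_one ht1) (hg.rpow g _) hθ).trans
    (CFC.rpow_le_rpow hθ ((hconj _ _).2 (by simpa only [add_sub_cancel] using hy)))

theorem mul_rpow_mul_le_rpow_two_add (hk : IsStrictlyPositive k) (hg : IsStrictlyPositive g)
    {α u : ℝ} (hα : 1 < α) (h : k * g ^ (-α) * k ≤ g ^ (2 - α)) (hu : -α ≤ u)
    (hu' : u ≤ α - 2) : k * g ^ u * k ≤ g ^ (2 + u) := by
  have hpos : 0 < 2 * α - 2 := by linarith
  have hdual : k * g ^ (α - 2) * k ≤ g ^ α := by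
    simpa only [neg_neg, neg_sub] using mul_rpow_neg_mul_le_rpow_neg (.of_nonneg hk.nonneg) hg h
  have hinterp := mul_rpow_mul_le_rpow_of_endpoints (θ := (u + α) / (2 * α - 2)) hk hg h hdual
    ⟨div_nonneg (by linarith) hpos.le, by rw [div_le_one hpos]; linarith⟩
  rw [show α - 2 - -α = 2 * α - 2 by ring, show α - (2 - α) = 2 * α - 2 by ring,
    mul_div_cancel₀ _ hpos.ne', show -α + (u + α) = u by ring,
    show 2 - α + (u + α) = 2 + u by ring] at hinterp
  exact hinterp

theorem rpow_le_rpow_of_mul_rpow_neg_mul_le (hk : IsStrictlyPositive k) (hg : IsStrictlyPositive g)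
    {α β : ℝ} (hα : 2 ≤ α) (h : k * g ^ (-α) * k ≤ g ^ (2 - α)) (hβ : 0 ≤ β) (hβα : β ≤ α) :
    k ^ β ≤ g ^ β := by
  have hmul {u : ℝ} (hu : 0 ≤ u) (hu' : u ≤ α - 2) : k * g ^ u * k ≤ g ^ (2 + u) :=
    mul_rpow_mul_le_rpow_two_add hk hg (by linarith) h (by linarith) hu'
  have hsq : k ^ (2 : ℝ) ≤ g ^ (2 : ℝ) := by
    have := hmul le_rfl (by linarith)
    rw [CFC.rpow_zero g hg.nonneg, mul_one, add_zero] at this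
    rwa [← one_add_one_eq_two, ← rpow_mul_rpow hk, CFC.rpow_one k hk.nonneg, one_add_one_eq_two]
  have hsmall {β : ℝ} (h0 : 0 ≤ β) (h2 : β ≤ 2) : k ^ β ≤ g ^ β := by
    have := CFC.rpow_le_rpow (p := β / 2) ⟨by linarith, by linarith⟩ hsq
    rwa [rpow_rpow hk, rpow_rpow hg, mul_div_cancel₀ _ two_ne_zero] at this
  obtain ⟨n, hn⟩ := exists_nat_ge (β / 2)
  induction n generalizing β with
  | zero => exact hsmall hβ (by norm_num at hn; linarith)
  | succ n ih =>
    rcases le_total β 2 with h2 | h2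
    · exact hsmall hβ h2
    have hconj := rpow_mul_mul_rpow_le (ih (β := β - 2) (by linarith) (by linarith)
      (by push_cast at hn; linarith)) k 1
    calc k ^ β = k ^ (1 : ℝ) * k ^ (β - 2) * k ^ (1 : ℝ) := by
          rw [rpow_mul_rpow_mul_rpow hk]; ring_nf
      _ ≤ k ^ (1 : ℝ) * g ^ (β - 2) * k ^ (1 : ℝ) := hconj
      _ ≤ g ^ (2 + (β - 2)) := by
          rw [CFC.rpow_one k hk.nonneg]; exact hmul (by linarith) (by linarith)
      _ = g ^ β := by rw [add_sub_cancel]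

end Interpolation

section NormComparison

theorem norm_le_norm_of_smul_le_one {x y : 𝒜} (hx : 0 ≤ x) (hy : 0 ≤ y)
    (h : ∀ c : ℝ, 0 < c → c • y ≤ 1 → c • x ≤ 1) : ‖x‖ ≤ ‖y‖ := by
  refine le_of_forall_pos_le_add fun ε hε => ?_
  have hpos : 0 < ‖y‖ + ε := by positivity
  have hiff {w : 𝒜} (hw : 0 ≤ w) : (‖y‖ + ε)⁻¹ • w ≤ 1 ↔ ‖w‖ ≤ ‖y‖ + ε := by
    rw [← CStarAlgebra.norm_le_one_iff_of_nonneg _ (smul_nonneg (by positivity) hw), norm_smul,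
      norm_inv, Real.norm_of_nonneg hpos.le, inv_mul_le_one₀ hpos]
  exact (hiff hx).1 (h _ (by positivity) ((hiff hy).2 (by linarith)))

theorem nonneg_subset_closure_isStrictlyPositive :
    {a : 𝒜 | 0 ≤ a} ⊆ closure {a | IsStrictlyPositive a} := by
  intro a ha
  have hcont : Continuous fun ε : ℝ => a + ε • (1 : 𝒜) := by fun_prop
  have hlim := (hcont.tendsto 0).mono_left (nhdsWithin_le_nhds (s := Set.Ioi 0))
  rw [zero_smul, add_zero] at hlim
  refine mem_closure_of_tendsto hlim ?_
  filter_upwards [self_mem_nhdsWithin] with ε hε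
  exact .nonneg_add ha (isStrictlyPositive_smul ⟨zero_le_one, isUnit_one⟩ hε)

theorem norm_le_norm_of_isStrictlyPositive {f g : 𝒜 → 𝒜} (hf : ContinuousOn f {a | 0 ≤ a})
    (hg : ContinuousOn g {a | 0 ≤ a}) (h : ∀ a, IsStrictlyPositive a → ‖f a‖ ≤ ‖g a‖) {a : 𝒜}
    (ha : 0 ≤ a) : ‖f a‖ ≤ ‖g a‖ :=
  have hsub : {a : 𝒜 | IsStrictlyPositive a} ⊆ {a | 0 ≤ a} := fun _ ha => ha.nonneg
  ContinuousWithinAt.closure_le (nonneg_subset_closure_isStrictlyPositive ha)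
    ((hf a ha).mono hsub).norm ((hg a ha).mono hsub).norm h

/-- `P_α(a, b)` for elements of a C⋆-algebra; on matrices with the operator norm this is `P`, and
the norm inequalities below are applied to compound matrices. -/
noncomputable def cstarP (α : ℝ) (a b : 𝒜) : 𝒜 :=
  b ^ (1 / 2 : ℝ) * (b ^ (-(1 / 2) : ℝ) * a * b ^ (-(1 / 2) : ℝ)) ^ α * b ^ (1 / 2 : ℝ)

/-- `Q_{α,z}(a, b)` for elements of a C⋆-algebra, the counterpart of `Q` to be compared in norm with
`cstarP`. -/
noncomputable def cstarQ (α z : ℝ) (a b : 𝒜) : 𝒜 :=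
  (b ^ ((1 - α) / (2 * z)) * a ^ (α / z) * b ^ ((1 - α) / (2 * z))) ^ z

variable {a b : 𝒜} {α z : ℝ}

theorem cstarP_nonneg : 0 ≤ cstarP α a b := rpow_mul_mul_rpow_nonneg CFC.rpow_nonneg b _

theorem cstarQ_nonneg : 0 ≤ cstarQ α z a b := CFC.rpow_nonneg

theorem smul_cstarP (ha : IsStrictlyPositive a) (hb : IsStrictlyPositive b) (hα : α ≠ 0) {c : ℝ}
    (hc : 0 < c) : c • cstarP α a b = cstarP α (c ^ α⁻¹ • a) b := by
  simp only [cstarP, mul_smul_comm, smul_mul_assoc]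
  rw [smul_rpow (isStrictlyPositive_rpow_mul_mul_rpow ha hb _) (by positivity),
    Real.rpow_inv_rpow hc.le hα, mul_smul_comm, smul_mul_assoc]

theorem smul_cstarQ (ha : IsStrictlyPositive a) (hb : IsStrictlyPositive b) (hα : α ≠ 0)
    (hz : z ≠ 0) {c : ℝ} (hc : 0 < c) : c • cstarQ α z a b = cstarQ α z (c ^ α⁻¹ • a) b := by
  rw [cstarQ, cstarQ, smul_rpow ha (by positivity), mul_smul_comm, smul_mul_assoc,
    smul_rpow (isStrictlyPositive_rpow_mul_mul_rpow (ha.rpow _ _) hb _) (by positivity),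
    ← Real.rpow_mul hc.le, ← Real.rpow_mul hc.le,
    show α⁻¹ * (α / z) * z = 1 by field_simp, Real.rpow_one]

theorem continuousOn_cstarP (hα : 0 < α) : ContinuousOn (fun a => cstarP α a b) {a | 0 ≤ a} :=
  (continuousOn_const.mul ((continuousOn_rpow hα).comp (by fun_prop) fun _ ha =>
    rpow_mul_mul_rpow_nonneg ha b _)).mul continuousOn_const

theorem continuousOn_cstarQ (hα : 0 < α) (hz : 0 < z) :
    ContinuousOn (fun a => cstarQ α z a b) {a | 0 ≤ a} :=
  (continuousOn_rpow hz).comp ((continuousOn_const.mul (continuousOn_rpow (div_pos hα hz))).mul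
    continuousOn_const) fun _ _ => rpow_mul_mul_rpow_nonneg CFC.rpow_nonneg b _

theorem cstarP_le_one_iff (hb : IsStrictlyPositive b) :
    cstarP α a b ≤ 1 ↔
      (b ^ (-(1 / 2) : ℝ) * a * b ^ (-(1 / 2) : ℝ)) ^ α ≤ b ^ (-1 : ℝ) := by
  have h := rpow_neg_mul_mul_rpow_neg_le_iff (b := 1)
    (a := (b ^ (-(1 / 2) : ℝ) * a * b ^ (-(1 / 2) : ℝ)) ^ α) hb (-(1 / 2))
  rwa [neg_neg, mul_one, rpow_mul_rpow hb, ← neg_add, add_halves] at h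

theorem cstarQ_le_one_iff (hb : IsStrictlyPositive b) (hz : 0 < z) :
    cstarQ α z a b ≤ 1 ↔ a ^ (α / z) ≤ b ^ ((α - 1) / z) := by
  rw [cstarQ, rpow_le_one_iff (rpow_mul_mul_rpow_nonneg CFC.rpow_nonneg b _) hz,
    show (1 - α) / (2 * z) = -((α - 1) / z / 2) by field_simp; ring,
    rpow_neg_mul_mul_rpow_neg_le_iff hb, mul_one, rpow_mul_rpow hb, add_halves]

theorem cstarP_le_one_of_lt_one (ha : IsStrictlyPositive a) (hb : IsStrictlyPositive b)
    (h0 : 0 < α) (h1 : α < 1) (hz : 0 < z) (h : cstarQ α z a b ≤ 1) : cstarP α a b ≤ 1 := by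
  rw [cstarQ_le_one_iff hb hz] at h
  have h1' : 0 < 1 - α := by linarith
  have hfuruta := rpow_mul_rpow_mul_rpow_rpow_le_rpow (ha.rpow a _) h (r := z / (1 - α))
    (s := z / α) (by positivity) (by positivity)
  rw [rpow_rpow ha, rpow_rpow hb, rpow_rpow hb, show α / z * (z / α) = 1 by field_simp,
    CFC.rpow_one a ha.nonneg,
    show (α - 1) / z * (z / (1 - α) / 2) = -(1 / 2) by field_simp; ring,
    show (α - 1) / z * (z / (1 - α)) = -1 by field_simp; ring,
    show z / (1 - α) / (z / α + z / (1 - α)) = α by field_simp; ring] at hfuruta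
  exact (cstarP_le_one_iff hb).2 hfuruta

theorem cstarP_le_one_of_le_two (ha : IsStrictlyPositive a) (hb : IsStrictlyPositive b)
    (h1 : 1 < α) (h2 : α ≤ 2) (hz : 0 < z) (hzα : z ≤ α - 1) (h : cstarQ α z a b ≤ 1) :
    cstarP α a b ≤ 1 := by
  rw [cstarQ_le_one_iff hb hz] at h
  have h1' : 0 < α - 1 := by linarith
  have hle : b ^ (2 * (-(1 / 2)) : ℝ) ≤ a ^ (-(α / (α - 1))) := by
    have := rpow_le_rpow_of_nonpos (r := -(z / (α - 1))) (ha.rpow a _) h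
      ⟨by rw [neg_le_neg_iff, div_le_one h1']; exact hzα, neg_nonpos.2 (by positivity)⟩
    rw [rpow_rpow ha, rpow_rpow hb] at this
    convert this using 2 <;> field_simp
  have hpow := rpow_mul_rpow_mul_rpow_rpow_le_of_le_rpow (s := 1) ha hb hle ⟨h1.le, h2⟩
  rw [CFC.rpow_one a ha.nonneg, show 1 * α + -(α / (α - 1)) * (α - 1) = 0 by field_simp; ring,
    CFC.rpow_zero a ha.nonneg, mul_one, rpow_mul_rpow hb, ← neg_add, add_halves] at hpow
  exact (cstarP_le_one_iff hb).2 hpow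

theorem cstarP_le_one_of_two_le (ha : IsStrictlyPositive a) (hb : IsStrictlyPositive b)
    (h2 : 2 ≤ α) (hz : 0 < z) (hzα : z ≤ α / 2) (h : cstarQ α z a b ≤ 1) : cstarP α a b ≤ 1 := by
  rw [cstarQ_le_one_iff hb hz] at h
  rw [cstarP_le_one_iff hb]
  have hα : 0 < α := by linarith
  set k := b ^ (-(1 / 2) : ℝ) * a * b ^ (-(1 / 2) : ℝ) with hk_def
  have hk : IsStrictlyPositive k := isStrictlyPositive_rpow_mul_mul_rpow ha hb _
  have hsq : a * a ≤ b ^ (2 * (α - 1) / α) := by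
    have := CFC.rpow_le_rpow (p := 2 * z / α)
      ⟨by positivity, by rw [div_le_one hα]; linarith⟩ h
    rw [rpow_rpow ha, rpow_rpow hb, show α / z * (2 * z / α) = 1 + 1 by field_simp; norm_num,
      ← rpow_mul_rpow ha, CFC.rpow_one a ha.nonneg] at this
    convert this using 2
    field_simp
  have hkbk : k * b * k = b ^ (-(1 / 2) : ℝ) * (a * a) * b ^ (-(1 / 2) : ℝ) := by
    calc _ = b ^ (-(1 / 2) : ℝ) * a * (b ^ (-(1 / 2) : ℝ) * b * b ^ (-(1 / 2) : ℝ)) *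
          a * b ^ (-(1 / 2) : ℝ) := by simp only [hk_def, mul_assoc]
      _ = _ := by rw [CFC.conjugate_rpow_neg_one_half b, mul_one, mul_assoc (b ^ _) a a]
  have hle : k * (b ^ (-(1 / α))) ^ (-α) * k ≤ (b ^ (-(1 / α))) ^ (2 - α) := by
    rw [rpow_rpow hb, rpow_rpow hb, show -(1 / α) * -α = 1 by field_simp,
      CFC.rpow_one b hb.nonneg, hkbk]
    refine (rpow_mul_mul_rpow_le hsq b _).trans_eq ?_
    rw [rpow_mul_rpow_mul_rpow hb]
    congr 1
    field_simp
    ring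
  have hpow := rpow_le_rpow_of_mul_rpow_neg_mul_le hk (hb.rpow b _) h2 hle hα.le le_rfl
  rwa [rpow_rpow hb, show -(1 / α) * α = -1 by field_simp] at hpow

theorem rpow_le_rpow_neg_div (ha : IsStrictlyPositive a) (hb : IsStrictlyPositive b) (hα : 0 < α)
    (h : a ^ α ≤ b ^ (-1 : ℝ)) {p : ℝ} (hp : p ∈ Set.Icc 0 α) : a ^ p ≤ b ^ (-(p / α)) := by
  have := CFC.rpow_le_rpow (p := p / α)
    ⟨div_nonneg hp.1 hα.le, (div_le_one hα).2 hp.2⟩ h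
  rwa [rpow_rpow ha, rpow_rpow hb, mul_div_cancel₀ _ hα.ne', neg_one_mul] at this

theorem cstarQ_le_one_of_max_le (ha : IsStrictlyPositive a) (hb : IsStrictlyPositive b)
    (h1 : 1 < α) (hz : max (α / 2) (α - 1) ≤ z) (h : cstarP α a b ≤ 1) : cstarQ α z a b ≤ 1 := by
  obtain ⟨hz2, hzα⟩ := max_le_iff.1 hz
  have hα : 0 < α := by linarith
  have hz0 : 0 < z := by linarith
  rw [cstarQ_le_one_iff hb hz0]
  rw [cstarP_le_one_iff hb] at h
  set k := b ^ (-(1 / 2) : ℝ) * a * b ^ (-(1 / 2) : ℝ)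
  have hk : IsStrictlyPositive k := isStrictlyPositive_rpow_mul_mul_rpow ha hb _
  have hak : a = b ^ (1 / 2 : ℝ) * k * b ^ (1 / 2 : ℝ) :=
    (rpow_mul_rpow_neg_mul_mul hb a _).symm
  rcases le_total α z with hαz | hαz
  · have hle : a ≤ b ^ ((α - 1) / α) := by
      have := rpow_mul_mul_rpow_le (rpow_le_rpow_neg_div hk hb hα h ⟨zero_le_one, h1.le⟩) b (1 / 2)
      rw [CFC.rpow_one k hk.nonneg, ← hak, rpow_mul_rpow_mul_rpow hb] at this
      convert this using 2
      field_simp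
      ring
    have hpow := CFC.rpow_le_rpow (p := α / z) ⟨by positivity, by rwa [div_le_one hz0]⟩ hle
    rw [rpow_rpow hb] at hpow
    convert hpow using 2
    field_simp
  · have hle : b ^ (2 * (1 / 2) : ℝ) ≤ k ^ (-α) := by
      have := rpow_le_rpow_of_nonpos (r := -1) (hk.rpow k _) h (by norm_num)
      rw [rpow_rpow hk, rpow_rpow hb] at this
      convert this using 2 <;> ring
    have hpow := rpow_mul_rpow_mul_rpow_rpow_le_of_le_rpow (s := 1) (r := α / z) hk hb hle
      ⟨by rwa [one_le_div hz0], by rw [div_le_iff₀ hz0]; linarith⟩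
    rw [CFC.rpow_one k hk.nonneg, ← hak,
      show 1 * (α / z) + -α * (α / z - 1) = α * (1 - (α - 1) / z) by field_simp; ring] at hpow
    have hz1 : (α - 1) / z ≤ 1 := by rwa [div_le_one hz0]
    have hz2 : 0 ≤ (α - 1) / z := div_nonneg (by linarith) hz0.le
    have hkb := rpow_le_rpow_neg_div hk hb hα h (p := α * (1 - (α - 1) / z))
      ⟨mul_nonneg hα.le (by linarith), mul_le_of_le_one_right hα.le (by linarith)⟩
    refine hpow.trans ((rpow_mul_mul_rpow_le hkb b _).trans_eq ?_)
    rw [rpow_mul_rpow_mul_rpow hb]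
    congr 1
    field_simp
    ring

theorem cstarP_le_one_of_cstarQ_le_one (ha : IsStrictlyPositive a) (hb : IsStrictlyPositive b)
    (hα : 0 < α) (hz : 0 < z) (hαz : α < 1 ∨ 1 < α ∧ z ≤ min (α / 2) (α - 1))
    (h : cstarQ α z a b ≤ 1) : cstarP α a b ≤ 1 := by
  rcases hαz with h1 | ⟨h1, hzα⟩
  · exact cstarP_le_one_of_lt_one ha hb hα h1 hz h
  obtain ⟨hz2, hz1⟩ := le_min_iff.1 hzα
  rcases le_total α 2 with h2 | h2
  · exact cstarP_le_one_of_le_two ha hb h1 h2 hz hz1 h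
  · exact cstarP_le_one_of_two_le ha hb h2 hz hz2 h

theorem norm_cstarP_le_norm_cstarQ (ha : 0 ≤ a) (hb : IsStrictlyPositive b) (hα : 0 < α)
    (hz : 0 < z) (hαz : α < 1 ∨ 1 < α ∧ z ≤ min (α / 2) (α - 1)) :
    ‖cstarP α a b‖ ≤ ‖cstarQ α z a b‖ := by
  refine norm_le_norm_of_isStrictlyPositive (continuousOn_cstarP hα) (continuousOn_cstarQ hα hz)
    (fun a ha => norm_le_norm_of_smul_le_one cstarP_nonneg cstarQ_nonneg fun c hc => ?_) ha
  rw [smul_cstarP ha hb hα.ne' hc, smul_cstarQ ha hb hα.ne' hz.ne' hc]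
  exact cstarP_le_one_of_cstarQ_le_one (isStrictlyPositive_smul ha (by positivity)) hb hα hz hαz

theorem norm_cstarQ_le_norm_cstarP (ha : 0 ≤ a) (hb : IsStrictlyPositive b) (hα : 1 < α)
    (hαz : max (α / 2) (α - 1) ≤ z) : ‖cstarQ α z a b‖ ≤ ‖cstarP α a b‖ := by
  have hα0 : 0 < α := by linarith
  have hz : 0 < z := by linarith [(max_le_iff.1 hαz).1]
  refine norm_le_norm_of_isStrictlyPositive (continuousOn_cstarQ hα0 hz) (continuousOn_cstarP hα0)
    (fun a ha => norm_le_norm_of_smul_le_one cstarQ_nonneg cstarP_nonneg fun c hc => ?_) ha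
  rw [smul_cstarP ha hb hα0.ne' hc, smul_cstarQ ha hb hα0.ne' hz.ne' hc]
  exact cstarQ_le_one_of_max_le (isStrictlyPositive_smul ha (by positivity)) hb hα hαz

end NormComparison

end CStarAlgebra

section Compound

open Matrix

theorem prod_ofFinEmbEquiv_symm {n M : Type*} [LinearOrder n] [CommMonoid M] {k : ℕ}
    (s : Set.powersetCard n k) (f : n → M) :
    ∏ j, f (Set.powersetCard.ofFinEmbEquiv.symm s j) = ∏ i ∈ (s : Finset n), f i := by
  rw [← Finset.map_orderEmbOfFin_univ (s : Finset n) s.2, Finset.prod_map]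
  rfl

variable {l m n R : Type*} [Fintype l] [LinearOrder l] [Fintype m] [LinearOrder m] [Fintype n]
  [LinearOrder n] [CommRing R] (k : ℕ)

/-- The `k`-th compound matrix: the matrix of the `k`-th exterior power of `A` in the standard
bases, both indexed by the `k`-element subsets. -/
noncomputable def compound (A : Matrix m n R) :
    Matrix (Set.powersetCard m k) (Set.powersetCard n k) R :=
  LinearMap.toMatrix ((Pi.basisFun R n).exteriorPower k) ((Pi.basisFun R m).exteriorPower k)
    (exteriorPower.map k A.toLin')

theorem compound_mul (A : Matrix l m R) (B : Matrix m n R) :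
    compound k (A * B) = compound k A * compound k B := by
  rw [compound, toLin'_mul, exteriorPower.map_comp,
    LinearMap.toMatrix_comp _ ((Pi.basisFun R m).exteriorPower k)]
  rfl

theorem compound_one : compound k (1 : Matrix n n R) = 1 := by
  rw [compound, toLin'_one, exteriorPower.map_id, LinearMap.toMatrix_id]

theorem compound_apply (A : Matrix m n R) (s t) :
    compound k A s t = (A.submatrix (Set.powersetCard.ofFinEmbEquiv.symm s)
      (Set.powersetCard.ofFinEmbEquiv.symm t)).det := by
  rw [compound, LinearMap.toMatrix_apply, exteriorPower.basis_apply,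
    exteriorPower.map_apply_ιMulti_family, exteriorPower.basis_repr_apply,
    exteriorPower.ιMulti_family, exteriorPower.ιMultiDual_apply_ιMulti, ← det_transpose]
  congr 1
  ext i j
  simp

theorem compound_conjTranspose [StarRing R] (A : Matrix m n R) :
    compound k Aᴴ = (compound k A)ᴴ := by
  ext s t
  rw [conjTranspose_apply, compound_apply, compound_apply, ← det_conjTranspose]
  rfl

theorem compound_diagonal (d : n → R) :
    compound k (diagonal d) =
      diagonal fun s : Set.powersetCard n k => ∏ i ∈ (s : Finset n), d i := by
  ext s t
  rw [compound_apply, diagonal_apply]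
  split_ifs with hst
  · rw [hst, ← RelEmbedding.coe_toEmbedding, submatrix_diagonal_embedding, det_diagonal]
    exact prod_ofFinEmbEquiv_symm t d
  · obtain ⟨i, his, hit⟩ := (Set.powersetCard.exists_mem_notMem_iff_ne s t).1 hst
    obtain ⟨j, rfl⟩ := (Set.powersetCard.mem_range_ofFinEmbEquiv_symm_iff_mem s i).2 his
    refine det_eq_zero_of_row_eq_zero j fun j' => diagonal_apply_ne _ fun h => hit ?_
    rw [h]
    exact (Set.powersetCard.mem_range_ofFinEmbEquiv_symm_iff_mem t _).1 ⟨j', rfl⟩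

end Compound

section Spectral

open Matrix Unitary
open scoped Matrix.Norms.L2Operator

variable {ι : Type*} [Fintype ι] [DecidableEq ι] {A : Matrix ι ι ℂ} {d : ι → ℝ}

theorem cfc_diagonal (f : ℝ → ℝ) (d : ι → ℝ) :
    cfc f (diagonal (RCLike.ofReal ∘ d) : Matrix ι ι ℂ) = diagonal (RCLike.ofReal ∘ f ∘ d) := by
  have hd : (diagonal (RCLike.ofReal ∘ d) : Matrix ι ι ℂ).IsHermitian :=
    isHermitian_diagonal_iff.2 fun i => RCLike.conj_ofReal (d i)
  set W : Matrix ι ι ℂ := (hd.eigenvectorUnitary : Matrix ι ι ℂ)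
  have hWu : W ∈ unitary (Matrix ι ι ℂ) := hd.eigenvectorUnitary.2
  have hfW : cfc f (diagonal (RCLike.ofReal ∘ d)) * W =
      W * diagonal (RCLike.ofReal ∘ f ∘ hd.eigenvalues) := by
    rw [hd.cfc_eq, IsHermitian.cfc, conjStarAlgAut_apply, mul_assoc, star_mul_self_of_mem hWu,
      mul_one]
  have hW : diagonal (RCLike.ofReal ∘ d) * W = W * diagonal (RCLike.ofReal ∘ hd.eigenvalues) := by
    conv_lhs => rw [hd.spectral_theorem]
    rw [conjStarAlgAut_apply, mul_assoc, star_mul_self_of_mem hWu, mul_one]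
  refine IsUnit.mul_right_cancel (toUnits ⟨W, hWu⟩).isUnit (hfW.trans ?_)
  ext i j
  have hij := congr_fun₂ hW i j
  rw [mul_diagonal, diagonal_mul]
  simp only [mul_diagonal, diagonal_mul, Function.comp_apply] at hij ⊢
  rcases eq_or_ne (W i j) 0 with h0 | h0
  · simp [h0]
  · rw [mul_comm, mul_right_inj' h0, RCLike.ofReal_inj] at hij
    rw [hij, mul_comm]

theorem cfc_conjStarAlgAut (U : unitary (Matrix ι ι ℂ)) (hA : A.IsHermitian) (f : ℝ → ℝ) :
    cfc f (conjStarAlgAut ℂ _ U A) = conjStarAlgAut ℂ _ U (cfc f A) :=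
  (StarAlgHomClass.map_cfc (R := ℝ) (S := ℂ) (conjStarAlgAut ℂ _ U) f A
    (finite_real_spectrum.continuousOn f) (StarAlgEquiv.isometry _).continuous hA
    (hA.isSelfAdjoint.map _)).symm

theorem conjStarAlgAut_diagonal_rpow (U : unitary (Matrix ι ι ℂ)) (hd : 0 ≤ d) (r : ℝ) :
    (conjStarAlgAut ℂ _ U (diagonal (RCLike.ofReal ∘ d))) ^ r =
      conjStarAlgAut ℂ _ U (diagonal (RCLike.ofReal ∘ fun i => d i ^ r)) := by
  have hpos : (diagonal (RCLike.ofReal ∘ d) : Matrix ι ι ℂ).PosSemidef :=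
    .diagonal fun i => Complex.zero_le_real.2 (hd i)
  rw [CFC.rpow_eq_cfc_real (map_nonneg _ hpos.nonneg), cfc_conjStarAlgAut U hpos.isHermitian,
    cfc_diagonal]
  rfl

theorem det_conjStarAlgAut (U : unitary (Matrix ι ι ℂ)) (A : Matrix ι ι ℂ) :
    (conjStarAlgAut ℂ _ U A).det = A.det := by
  rw [conjStarAlgAut_apply, det_mul_comm, ← mul_assoc, star_mul_self_of_mem U.2, one_mul]

theorem norm_det_rpow (hA : A.PosSemidef) (r : ℝ) : ‖(A ^ r).det‖ = ‖A.det‖ ^ r := by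
  have hnorm (d : ι → ℝ) (hd : 0 ≤ d) :
      ‖(diagonal (RCLike.ofReal ∘ d) : Matrix ι ι ℂ).det‖ = ∏ i, d i := by
    simp only [det_diagonal, norm_prod, Function.comp_apply, RCLike.norm_ofReal,
      abs_of_nonneg (hd _)]
  have heig : 0 ≤ hA.isHermitian.eigenvalues := hA.eigenvalues_nonneg
  rw [hA.isHermitian.spectral_theorem, conjStarAlgAut_diagonal_rpow _ heig, det_conjStarAlgAut,
    det_conjStarAlgAut, hnorm _ heig, hnorm _ fun i => Real.rpow_nonneg (heig i) r,
    Real.finsetProd_rpow _ _ fun i _ => heig i]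

theorem norm_conjStarAlgAut_diagonal (U : unitary (Matrix ι ι ℂ)) (d : ι → ℝ) :
    ‖conjStarAlgAut ℂ _ U (diagonal (RCLike.ofReal ∘ d))‖ = ‖d‖ := by
  rw [StarAlgEquiv.norm_map, l2_opNorm_diagonal]
  simp [Pi.norm_def]

end Spectral

section CompoundSpectral

open Matrix Unitary
open scoped Matrix.Norms.L2Operator

variable {ι : Type*} [Fintype ι] [LinearOrder ι] (k : ℕ) {A : Matrix ι ι ℂ}

theorem compound_mem_unitary (U : unitary (Matrix ι ι ℂ)) :
    compound k (U : Matrix ι ι ℂ) ∈ unitary _ := by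
  rw [mem_iff, star_eq_conjTranspose, ← compound_conjTranspose, ← compound_mul, ← compound_mul,
    ← star_eq_conjTranspose, star_mul_self_of_mem U.2, mul_star_self_of_mem U.2, compound_one]
  exact ⟨rfl, rfl⟩

theorem compound_conjStarAlgAut_diagonal (U : unitary (Matrix ι ι ℂ)) (d : ι → ℝ) :
    compound k (conjStarAlgAut ℂ _ U (diagonal (RCLike.ofReal ∘ d))) =
      conjStarAlgAut ℂ (Matrix (Set.powersetCard ι k) (Set.powersetCard ι k) ℂ)
        ⟨compound k (U : Matrix ι ι ℂ), compound_mem_unitary k U⟩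
        (diagonal (RCLike.ofReal ∘ fun s => ∏ i ∈ (s : Finset ι), d i)) := by
  rw [conjStarAlgAut_apply, conjStarAlgAut_apply, compound_mul, compound_mul, compound_diagonal,
    star_eq_conjTranspose, star_eq_conjTranspose, compound_conjTranspose]
  simp only [Function.comp_def, map_prod]

theorem posSemidef_compound (hA : A.PosSemidef) : (compound k A).PosSemidef := by
  obtain ⟨C, rfl⟩ := CStarAlgebra.nonneg_iff_eq_star_mul_self.1 hA.nonneg
  rw [compound_mul, star_eq_conjTranspose, compound_conjTranspose]
  exact posSemidef_conjTranspose_mul_self _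

theorem isStrictlyPositive_compound (hA : A.PosDef) : IsStrictlyPositive (compound k A) := by
  obtain ⟨C, hC⟩ := hA.isUnit.exists_right_inv
  refine ⟨(posSemidef_compound k hA.posSemidef).nonneg, .of_mul_eq_one (compound k C) ?_⟩
  rw [← compound_mul, hC, compound_one]

theorem compound_rpow (hA : A.PosSemidef) (r : ℝ) : compound k (A ^ r) = compound k A ^ r := by
  have heig : 0 ≤ hA.isHermitian.eigenvalues := hA.eigenvalues_nonneg
  rw [hA.isHermitian.spectral_theorem, conjStarAlgAut_diagonal_rpow _ heig,
    compound_conjStarAlgAut_diagonal, compound_conjStarAlgAut_diagonal,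
    conjStarAlgAut_diagonal_rpow _ fun s => Finset.prod_nonneg fun i _ => heig i]
  simp only [Real.finsetProd_rpow _ _ fun i _ => heig i]

end CompoundSpectral

section LargestProducts

theorem val_le_val_of_strictMono {k m : ℕ} {f : Fin k → Fin m} (hf : StrictMono f) (j : Fin k) :
    j.val ≤ (f j).val := by
  simpa only [Fin.card_Iio] using Finset.card_le_card_of_injOn (s := Finset.Iio j)
    (t := Finset.Iio (f j)) f (fun i hi => by simpa using hf (by simpa using hi))
    hf.injective.injOn

theorem prod_val_lt_eq_prod_castLE {M : Type*} [CommMonoid M] {k m : ℕ} (hkm : k ≤ m)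
    (f : Fin m → M) : ∏ i : Fin m with i.val < k, f i = ∏ j : Fin k, f (j.castLE hkm) := by
  have : (Finset.univ.filter fun i : Fin m => i.val < k) =
      Finset.univ.map (Fin.castLEEmb hkm) := by
    ext i
    simp only [Finset.mem_filter, Finset.mem_univ, true_and, Finset.mem_map]
    exact ⟨fun h => ⟨⟨i, h⟩, rfl⟩, by rintro ⟨j, rfl⟩; exact j.2⟩
  rw [this, Finset.prod_map]
  rfl

theorem prod_le_prod_val_lt_of_antitone {m : ℕ} {f : Fin m → ℝ} (hf : Antitone f)
    (hf0 : 0 ≤ f) (s : Finset (Fin m)) :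
    ∏ i ∈ s, f i ≤ ∏ i : Fin m with i.val < s.card, f i := by
  have hs : s.card ≤ m := by simpa using s.card_le_univ
  rw [prod_val_lt_eq_prod_castLE hs]
  conv_lhs => rw [← Finset.map_orderEmbOfFin_univ s rfl, Finset.prod_map]
  exact Finset.prod_le_prod (fun _ _ => hf0 _) fun j _ =>
    hf (val_le_val_of_strictMono (s.orderEmbOfFin rfl).strictMono j)

theorem norm_prod_powersetCard_of_antitone {ι : Type*} [Fintype ι] {k m : ℕ} (hkm : k ≤ m)
    (σ : ι ≃ Fin m) {f : Fin m → ℝ} (hf : Antitone f) (hf0 : 0 ≤ f) :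
    ‖fun s : Set.powersetCard ι k => ∏ i ∈ (s : Finset ι), f (σ i)‖ =
      ∏ i : Fin m with i.val < k, f i := by
  have hprod (s : Finset (Fin m)) : 0 ≤ ∏ i ∈ s, f i := Finset.prod_nonneg fun i _ => hf0 i
  have hnorm (s : Set.powersetCard ι k) :
      ‖∏ i ∈ (s : Finset ι), f (σ i)‖ = ∏ i ∈ (s : Finset ι).map σ.toEmbedding, f i := by
    rw [← Real.norm_of_nonneg (hprod _), Finset.prod_map]
    rfl
  refine le_antisymm ((pi_norm_le_iff_of_nonneg (hprod _)).2 fun s => ?_) ?_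
  · have hcard : ((s : Finset ι).map σ.toEmbedding).card = k := by rw [Finset.card_map, s.2]
    simpa only [hnorm, hcard] using
      prod_le_prod_val_lt_of_antitone hf hf0 ((s : Finset ι).map σ.toEmbedding)
  · set t : Finset (Fin m) := {i | i.val < k}
    have ht : (t.map σ.symm.toEmbedding).card = k := by
      rw [Finset.card_map, Fin.card_filter_val_lt, min_eq_right hkm]
    refine le_of_eq_of_le ?_ (norm_le_pi_norm _ (Set.powersetCard.ofCard ht))
    rw [hnorm, Set.powersetCard.val_ofCard, Finset.prod_map, Finset.prod_map]
    simp only [Equiv.coe_toEmbedding, Equiv.apply_symm_apply]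

end LargestProducts

section Eigenvalues

open Matrix
open scoped Matrix.Norms.L2Operator

variable {ι : Type*} [Fintype ι]

theorem eigenvalues₀_nonneg [DecidableEq ι] {A : Matrix ι ι ℂ} (hA : A.PosSemidef) :
    0 ≤ hA.isHermitian.eigenvalues₀ := fun i => by
  have h := hA.eigenvalues_nonneg (Fintype.equivOfCardEq (Fintype.card_fin _) i)
  rwa [IsHermitian.eigenvalues, Equiv.symm_apply_apply] at h

theorem prod_eigenvalues₀_eq_norm_det [DecidableEq ι] {A : Matrix ι ι ℂ} (hA : A.PosSemidef) :
    ∏ i, hA.isHermitian.eigenvalues₀ i = ‖A.det‖ := by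
  have h : ∏ i, hA.isHermitian.eigenvalues i = ∏ i, hA.isHermitian.eigenvalues₀ i :=
    (Fintype.equivOfCardEq (Fintype.card_fin _)).symm.prod_comp hA.isHermitian.eigenvalues₀
  rw [hA.isHermitian.det_eq_prod_eigenvalues, norm_prod, ← h]
  simp only [RCLike.norm_ofReal, abs_of_nonneg (hA.eigenvalues_nonneg _)]

theorem norm_compound [LinearOrder ι] {A : Matrix ι ι ℂ} (hA : A.PosSemidef) {k : ℕ}
    (hk : k ≤ Fintype.card ι) :
    ‖compound k A‖ =
      ∏ i : Fin (Fintype.card ι) with i.val < k, hA.isHermitian.eigenvalues₀ i := by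
  conv_lhs => rw [hA.isHermitian.spectral_theorem, compound_conjStarAlgAut_diagonal]
  rw [norm_conjStarAlgAut_diagonal]
  exact norm_prod_powersetCard_of_antitone hk _ hA.isHermitian.eigenvalues₀_antitone
    (eigenvalues₀_nonneg hA)

end Eigenvalues

section LogMajorization

open Matrix
open scoped Matrix.Norms.L2Operator

variable {ι : Type*} [Fintype ι]

section Determinant

variable [DecidableEq ι] {A B : Matrix ι ι ℂ} {α z : ℝ}

theorem norm_det_pos (hB : B.PosDef) : 0 < ‖B.det‖ := norm_pos_iff.2 hB.det_pos.ne'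

theorem norm_det_P (hA : A.PosSemidef) (hB : B.PosDef) :
    ‖(P α A B).det‖ = ‖A.det‖ ^ α * ‖B.det‖ ^ (1 - α) := by
  have hb := norm_det_pos hB
  have hpow := norm_det_rpow (rpow_mul_mul_rpow_nonneg hA.nonneg B (-(1 / 2))).posSemidef α
  simp only [det_mul, norm_mul, norm_det_rpow hB.posSemidef] at hpow
  simp only [P, det_mul, norm_mul, hpow, norm_det_rpow hB.posSemidef]
  rw [Real.mul_rpow (by positivity) (by positivity), Real.mul_rpow (by positivity) (by positivity),
    ← Real.rpow_mul hb.le]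
  calc _ = ‖A.det‖ ^ α * (‖B.det‖ ^ (1 / 2 : ℝ) * ‖B.det‖ ^ (-(1 / 2) * α) *
        ‖B.det‖ ^ (-(1 / 2) * α) * ‖B.det‖ ^ (1 / 2 : ℝ)) := by ring
    _ = _ := by simp only [← Real.rpow_add hb]; ring_nf

theorem norm_det_Q (hA : A.PosSemidef) (hB : B.PosDef) (hz : z ≠ 0) :
    ‖(Q α z A B).det‖ = ‖A.det‖ ^ α * ‖B.det‖ ^ (1 - α) := by
  have hb := norm_det_pos hB
  rw [Q, norm_det_rpow (rpow_mul_mul_rpow_nonneg CFC.rpow_nonneg B _).posSemidef]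
  simp only [det_mul, norm_mul, norm_det_rpow hB.posSemidef, norm_det_rpow hA]
  rw [mul_right_comm, ← Real.rpow_add hb, Real.mul_rpow (by positivity) (by positivity),
    ← Real.rpow_mul hb.le, ← Real.rpow_mul (norm_nonneg _), div_mul_cancel₀ _ hz, mul_comm]
  congr 2
  field_simp
  ring

end Determinant

variable [LinearOrder ι] {A B X Y : Matrix ι ι ℂ} {α z : ℝ}

theorem logMajorizedBy_of_norm_compound_le (hX : X.PosSemidef) (hY : Y.PosSemidef)
    (h : ∀ k, ‖compound k X‖ ≤ ‖compound k Y‖) (hdet : ‖X.det‖ = ‖Y.det‖) :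
    LogMajorizedBy X Y := by
  refine ⟨hX, hY, fun k _ hk => ?_, ?_⟩
  · rw [← norm_compound hX hk, ← norm_compound hY hk]
    exact h k
  · rw [prod_eigenvalues₀_eq_norm_det hX, prod_eigenvalues₀_eq_norm_det hY, hdet]

theorem compound_P (k : ℕ) (hA : A.PosSemidef) (hB : B.PosSemidef) :
    compound k (P α A B) = cstarP α (compound k A) (compound k B) := by
  simp only [P, cstarP, compound_mul, compound_rpow k hB,
    compound_rpow k (rpow_mul_mul_rpow_nonneg hA.nonneg B (-(1 / 2))).posSemidef]

theorem compound_Q (k : ℕ) (hA : A.PosSemidef) (hB : B.PosSemidef) :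
    compound k (Q α z A B) = cstarQ α z (compound k A) (compound k B) := by
  simp only [Q, cstarQ, compound_mul, compound_rpow k hA, compound_rpow k hB,
    compound_rpow k (rpow_mul_mul_rpow_nonneg (CFC.rpow_nonneg (a := A)) B _).posSemidef]

theorem P_logMajorizedBy_Q (hA : A.PosSemidef) (hB : B.PosDef) (hα : 0 < α) (hz : 0 < z)
    (hαz : α < 1 ∨ 1 < α ∧ z ≤ min (α / 2) (α - 1)) : LogMajorizedBy (P α A B) (Q α z A B) := by
  refine logMajorizedBy_of_norm_compound_le cstarP_nonneg.posSemidef cstarQ_nonneg.posSemidef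
    (fun k => ?_) ((norm_det_P hA hB).trans (norm_det_Q hA hB hz.ne').symm)
  rw [compound_P k hA hB.posSemidef, compound_Q k hA hB.posSemidef]
  exact norm_cstarP_le_norm_cstarQ (posSemidef_compound k hA).nonneg
    (isStrictlyPositive_compound k hB) hα hz hαz

theorem Q_logMajorizedBy_P (hA : A.PosSemidef) (hB : B.PosDef) (hα : 1 < α)
    (hαz : max (α / 2) (α - 1) ≤ z) : LogMajorizedBy (Q α z A B) (P α A B) := by
  have hz : 0 < z := by linarith [(max_le_iff.1 hαz).1]
  refine logMajorizedBy_of_norm_compound_le cstarQ_nonneg.posSemidef cstarP_nonneg.posSemidef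
    (fun k => ?_) ((norm_det_Q hA hB hz.ne').trans (norm_det_P hA hB).symm)
  rw [compound_P k hA hB.posSemidef, compound_Q k hA hB.posSemidef]
  exact norm_cstarQ_le_norm_cstarP (posSemidef_compound k hA).nonneg
    (isStrictlyPositive_compound k hB) hα hαz

end LogMajorization

end Renyi

theorem theorem1p1_general {ι : Type*} [Fintype ι] [DecidableEq ι] {A B : Matrix ι ι ℂ}
    (hA : A.PosSemidef) (hB : B.PosDef) :
    (∀ α z : ℝ, 0 < α → α < 1 → 0 < z →
      Renyi.LogMajorizedBy (Renyi.P α A B) (Renyi.Q α z A B)) ∧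
    (∀ α z : ℝ, 1 < α → 0 < z → z ≤ min (α / 2) (α - 1) →
      Renyi.LogMajorizedBy (Renyi.P α A B) (Renyi.Q α z A B)) ∧
    (∀ α z : ℝ, 1 < α → max (α / 2) (α - 1) ≤ z →
      Renyi.LogMajorizedBy (Renyi.Q α z A B) (Renyi.P α A B)) ∧
    (∀ α : ℝ, (0 < α ∧ α < 1) ∨ 2 ≤ α →
      Renyi.LogMajorizedBy (Renyi.P α A B) (Renyi.Q₁ α A B)) ∧
    (∀ α : ℝ, 1 < α → α ≤ 2 →
      Renyi.LogMajorizedBy (Renyi.Q₁ α A B) (Renyi.P α A B)) := by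
  obtain ⟨_, rfl⟩ : ∃ o : LinearOrder ι, o.toDecidableEq = ‹DecidableEq ι› :=
    ⟨LinearOrder.lift' (Fintype.equivFin ι) (Equiv.injective _), Subsingleton.elim _ _⟩
  refine ⟨fun α z h0 h1 hz => Renyi.P_logMajorizedBy_Q hA hB h0 hz (.inl h1),
    fun α z h1 hz hzα => Renyi.P_logMajorizedBy_Q hA hB (by linarith) hz (.inr ⟨h1, hzα⟩),
    fun α z h1 hzα => Renyi.Q_logMajorizedBy_P hA hB h1 hzα, ?_, fun α h1 h2 => ?_⟩
  · rintro α (⟨h0, h1⟩ | h2)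
    · exact Renyi.P_logMajorizedBy_Q hA hB h0 one_pos (.inl h1)
    · exact Renyi.P_logMajorizedBy_Q hA hB (by linarith) one_pos
        (.inr ⟨by linarith, le_min (by linarith) (by linarith)⟩)
  · exact Renyi.Q_logMajorizedBy_P hA hB h1 (max_le (by linarith) (by linarith))

theorem theorem1p1 (n : ℕ) (A B : Matrix (Fin n) (Fin n) ℂ)
    (hA : A.PosSemidef) (hB : B.PosDef) :
    (∀ α z : ℝ, 0 < α → α < 1 → 0 < z →
      Renyi.LogMajorizedBy (Renyi.P α A B) (Renyi.Q α z A B)) ∧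
    (∀ α z : ℝ, 1 < α → 0 < z → z ≤ min (α / 2) (α - 1) →
      Renyi.LogMajorizedBy (Renyi.P α A B) (Renyi.Q α z A B)) ∧
    (∀ α z : ℝ, 1 < α → max (α / 2) (α - 1) ≤ z →
      Renyi.LogMajorizedBy (Renyi.Q α z A B) (Renyi.P α A B)) ∧
    (∀ α : ℝ, (0 < α ∧ α < 1) ∨ 2 ≤ α →
      Renyi.LogMajorizedBy (Renyi.P α A B) (Renyi.Q₁ α A B)) ∧
    (∀ α : ℝ, 1 < α → α ≤ 2 →
      Renyi.LogMajorizedBy (Renyi.Q₁ α A B) (Renyi.P α A B)) := by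
  exact theorem1p1_general hA hB
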